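/- **Theorem (Lower bound for learning from video).** *Setting.* An Ex-Block MDP has finite sets $\mathcal S$ (endogenous states) and $\mathcal A$ (actions), a set $\Xi$ of exogenous noise values, a set $\mathcal X$ of observations, initial laws $\mu\in\Delta(\mathcal S)$, $\mu_\xi\in\Delta(\Xi)$, transitions $T:\mathcal S\times\mathcal A\to\Delta(\mathcal S)$ and $T_\xi:\Xi\to\Delta(\Xi)$, rewards $R:\mathcal S\times\mathcal A\to[0,1]$ and emissions $q:\mathcal S\times\Xi\to\Delta(\mathcal X)$ such that $s=\phi^\star(x)$ and $\xi=\phi^\star_\xi(x)$ whenever $q(x\mid s,\xi)>0$, for some decoders $\phi^\star,\phi^\star_\xi$. In an episode, $s_1\sim\mu$, $\xi_1\sim\mu_\xi$, $x_h\sim q(\cdot\mid s_h,\xi_h)$, $r_h=R(s_h,a_h)$, $s_{h+1}\sim T(\cdot\mid s_h,a_h)$, $\xi_{h+1}\sim T_\xi(\cdot\mid\xi_h)$. The value $V_M(\pi)$ of a policy $\pi=(\pi_h:\mathcal X\to\mathcal A)_{h\le H}$ is the expectation of $r_1+\dots+r_H$, and $V_M^\star=\max_\pi V_M(\pi)$.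 A video of $T$ frames is the sequence $(x_1,\dots,x_T)$ of an episode run by a policy $\mathcal X\to\Delta(\mathcal A)$ drawn from a mixture $\Theta$ of such policies. An *instance* is a pair $(M,\Theta)$. Fix $K\ge1$; videos have $H+K$ frames. For $\omega\in\Delta([K])$, a multistep transition $(x,k,x')$ is obtained from a video by $x=x_h$, $x'=x_{h+k}$ with $h\sim\mathrm{Unf}([H])$, $k\sim\omega$; let $\rho$ be the law of $\phi^\star(x)$. With a fair coin $z$, a contrastive tuple is $(x,k,x',1)$ if $z=1$, and $(x,k,\tilde x,0)$ if $z=0$, where $\tilde x$ is the first frame of an independent multistep transition. The margins are $$\beta_{\rm for}=\min_{s_1\ne s_2}\mathbb E_{k\sim\omega}\big\|\mathbb P(x'=\cdot\mid\phi^\star(x)=s_1,k)-\mathbb P(x'=\cdot\mid\phi^\star(x)=s_2,k)\big\|_{TV},$$ $$\beta_{\rm temp}=\min_{s_1\ne s_2}\tfrac12\,\mathbb E_{k\sim\omega,\,s'\sim\rho}\big|\mathbb P(z=1\mid s_1,k,s')-\mathbb P(z=1\mid s_2,k,s')\big|,$$ where $\mathbb P(z=1\mid s,k,s')$ is the probability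 that $z=1$ given that the first frame of the contrastive tuple has state $s$, the offset is $k$, and the second frame has state $s'$. *Statement.* There are universal constants $C,r$ such that the following holds for all finite $\mathcal S,\mathcal A$ with $|\mathcal S|,|\mathcal A|\ge2$, all $H\ge2$, $K\ge1$, $\varepsilon\in(0,1)$ and $\delta\in(0,1)$. There are finite sets $\mathcal X,\Xi$ and a class $\mathcal M$ of instances $(M,\Theta)$ over $\mathcal X,\mathcal S,\Xi,\mathcal A$ such that: 1. Every member of $\mathcal M$ satisfies: the observations $x_1,\dots,x_{H+K}$ encode the time step; coverage (there is $\eta_{\min}>0$ such that, for every $h\le H$, every state that some policy reaches at step $h$ with positive probability has probability at least $\eta_{\min}$ at step $h$ of a video); noise-free data (every policy in the support of $\Theta$ depends on $x$ only through $\phi^\star(x)$); and the margin assumption (for every $\omega\in\Delta([K])$, $\rho(s)>0$ for all $s$, $\beta_{\rm for}>0$ and $\beta_{\rm temp}>0$). 2. The class is PAC learnable from trajectories: for all $\varepsilon'\in(0,\varepsilon]$ and $\delta'\in(0,\delta]$ there are a number $N\le C\,(|\mathcal S|+|\mathcal A|+H+1/\varepsilon'+\ln(1/\delta'))^r$ and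 one online algorithm that, on every $M$ in the class, observes the observations, actions and rewards of $N$ episodes and returns a policy $\hat\pi$ with $V_M^\star-V_M(\hat\pi)\le\varepsilon'$ with probability at least $1-\delta'$. 3. Let $L\le 2^{1/(4\varepsilon)-1}$, let $n$ and $N$ be arbitrary, let $\mathscr A_1$ be any (randomized) algorithm that maps $n$ videos to a decoder $\phi=(\phi_h:\mathcal X\to[L])_{h\le H}$, and let $\mathscr A_2$ be any (randomized) online RL algorithm that, given $\phi$, interacts for $N$ episodes, seeing states only through $\phi$, and outputs an abstract policy $\psi=(\psi_h:[L]\to\mathcal A)_{h\le H}$; put $\hat\pi_h=\psi_h\circ\phi_h$. Then there is $(M,\Theta)\in\mathcal M$ such that, when $\mathscr A_1$ is run on $n$ i.i.d. videos of $(M,\Theta)$ and $\mathscr A_2$ is run on $M$: with probability at least $1-\delta$ over the videos and the randomness of $\mathscr A_1$, the learned $\phi$ is such that every policy $\hat\pi$ that $\mathscr A_2$ outputs with positive probability satisfies $$V_M^\star-V_M(\hat\pi)>\varepsilon;$$ moreover $V_M^\star-\mathbb E[V_M(\hat\pi)]>\varepsilon$, the expectation being over the videos and all randomness of both algorithms.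 -/

import Mathlib

namespace VideoRL

noncomputable section

/-- Probability of an event under a discrete distribution. -/
def prob {α : Type*} (p : PMF α) (E : Set α) : ℝ := (p.toOuterMeasure E).toReal

/-- Expectation of a real function under a discrete distribution (only used for bounded `f`). -/
def expect {α : Type*} (p : PMF α) (f : α → ℝ) : ℝ := ∑' a, (p a).toReal * f a

/-- `n` independent samples from `p`. -/
def iid {α : Type*} (p : PMF α) : (n : ℕ) → PMF (Fin n → α)
  | 0 => PMF.pure Fin.elim0
  | n + 1 => p.bind fun a => (iid p n).map (Fin.cons a)

/-- Total variation distance between two real functions on a countable set. -/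
def tvDist {α : Type*} (f g : α → ℝ) : ℝ := (1 / 2) * ∑' a, |f a - g a|

/-- An exogenous block MDP (without its horizon): observations `X`, endogenous states `S`,
exogenous noise `Ξ`, actions `A`.  The emission is disjoint: both the endogenous state and the
exogenous noise can be decoded from the observation. -/
structure ExBlockMDP (X S Ξ A : Type) where
  init : PMF S
  initExo : PMF Ξ
  trans : S → A → PMF S
  transExo : Ξ → PMF Ξ
  emit : S → Ξ → PMF X
  reward : S → A → ℝ
  reward_mem : ∀ s a, reward s a ∈ Set.Icc (0 : ℝ) 1
  decode : X → S
  decodeExo : X → Ξ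
  decode_emit : ∀ s ξ, ∀ x ∈ (emit s ξ).support, decode x = s ∧ decodeExo x = ξ

/-- An episode of `n` steps as seen by an agent: at every step what is observed, the action
and the reward. -/
abbrev Episode (O A : Type) (n : ℕ) : Type := Fin n → O × A × ℝ

/-- A randomized, history dependent way of acting during an episode of `n` steps: the arguments
are the time step, the list of the earlier steps of this episode (in chronological order) and
the current observation. -/
abbrev Agent (O A : Type) (n : ℕ) : Type := Fin n → List (O × A × ℝ) → O → PMF A

/-- The agent that follows a deterministic Markov policy. -/
def detAgent {O A : Type} {n : ℕ} (π : Fin n → O → A) : Agent O A n :=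
  fun h _ o => PMF.pure (π h o)

/-- The agent that follows a stochastic time homogeneous Markov policy. -/
def stationaryAgent {O A : Type} (n : ℕ) (π : O → PMF A) : Agent O A n :=
  fun _ _ o => π o

/-- An online algorithm that interacts for a number of episodes with an environment of
horizon `H`.  The behaviour in an episode may depend on all earlier episodes; after the last
episode it outputs a (random) policy. -/
structure OnlineAlg (O A : Type) (H : ℕ) where
  act : List (Episode O A H) → Agent O A H
  output : List (Episode O A H) → PMF (Fin H → O → A)

namespace ExBlockMDP

variable {X S Ξ A O : Type}

/-- The law of the next `n` steps from the latent pair `(s, ξ)`, when the agent observes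
`φ h x` in place of the observation `x` at step `h`. -/
def rollout (M : ExBlockMDP X S Ξ A) :
    (n : ℕ) → (Fin n → X → O) → Agent O A n → S → Ξ → PMF (Episode O A n)
  | 0, _, _, _, _ => PMF.pure Fin.elim0
  | n + 1, φ, π, s, ξ =>
    (M.emit s ξ).bind fun x =>
    (π 0 [] (φ 0 x)).bind fun a =>
    (M.trans s a).bind fun s' =>
    (M.transExo ξ).bind fun ξ' =>
    (M.rollout n (fun h => φ h.succ)
      (fun h past => π h.succ ((φ 0 x, a, M.reward s a) :: past)) s' ξ').map
      (Fin.cons (α := fun _ => O × A × ℝ) (φ 0 x, a, M.reward s a))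

/-- The law of an episode of `n` steps of an agent that observes states only through `φ`. -/
def episode (M : ExBlockMDP X S Ξ A) (n : ℕ) (φ : Fin n → X → O) (π : Agent O A n) :
    PMF (Episode O A n) :=
  M.init.bind fun s => M.initExo.bind fun ξ => M.rollout n φ π s ξ

/-- The law of an episode of an agent that sees the observations themselves. -/
def rawEpisode (M : ExBlockMDP X S Ξ A) (n : ℕ) (π : Agent X A n) : PMF (Episode X A n) :=
  M.episode n (fun _ x => x) π

/-- The value (expected return over `H` steps) of a policy. -/
def value (M : ExBlockMDP X S Ξ A) (H : ℕ) (π : Fin H → X → A) : ℝ :=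
  expect (M.rawEpisode H (detAgent π)) fun τ => ∑ h, (τ h).2.2

/-- The optimal value. -/
def optValue (M : ExBlockMDP X S Ξ A) (H : ℕ) : ℝ := ⨆ π : Fin H → X → A, M.value H π

/-- The law of the list of the next `N` episodes of the algorithm, after the episodes `past`. -/
def interact (M : ExBlockMDP X S Ξ A) (H : ℕ) (φ : Fin H → X → O) (alg : OnlineAlg O A H) :
    ℕ → List (Episode O A H) → PMF (List (Episode O A H))
  | 0, past => PMF.pure past
  | N + 1, past =>
    (M.episode H φ (alg.act past)).bind fun τ => M.interact H φ alg N (past ++ [τ])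

/-- The law of the policy that the algorithm outputs after `N` episodes in which it observes
states only through `φ`. -/
def outputLaw (M : ExBlockMDP X S Ξ A) (H N : ℕ) (φ : Fin H → X → O) (alg : OnlineAlg O A H) :
    PMF (Fin H → O → A) :=
  (M.interact H φ alg N []).bind alg.output

/-- The law of a video of `T` frames.  The data are generated by a mixture `Θ` of Markov
policies: a policy is drawn from `Θ` and a whole episode is generated with it; actions and
rewards are not recorded. -/
def videoLaw (M : ExBlockMDP X S Ξ A) (Θ : PMF (X → PMF A)) (T : ℕ) : PMF (Fin T → X) :=
  Θ.bind fun π => (M.rawEpisode T (stationaryAgent T π)).map fun τ h => (τ h).1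

/-- Observations encode the time step, during the first `T` steps. -/
def EncodesTime (M : ExBlockMDP X S Ξ A) (T : ℕ) : Prop :=
  ∃ clock : X → ℕ, ∀ (π : Agent X A T), ∀ τ ∈ (M.rawEpisode T π).support,
    ∀ h : Fin T, clock (τ h).1 = h

/-- Requirements on the data collection: every state that some policy reaches at step `h` has
probability at least `η` at step `h` of a video, and every data collection policy depends on the
endogenous state only. -/
def DataCollection (M : ExBlockMDP X S Ξ A) (Θ : PMF (X → PMF A)) (H : ℕ) : Prop :=
  (∃ η : ℝ, 0 < η ∧ ∀ (h : Fin H) (s : S),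
    (∃ π : Fin H → X → A,
      0 < prob (M.rawEpisode H (detAgent π)) {τ | M.decode (τ h).1 = s}) →
    η ≤ prob (M.videoLaw Θ H) {v | M.decode (v h) = s}) ∧
  ∀ π ∈ Θ.support, ∃ σ : S → PMF A, ∀ x, π x = σ (M.decode x)

/-- Multistep transitions `(x, k, x')` of the video data: a video, a step `h` uniform in the
first `H` steps, an offset `k` drawn from `ω`, the frames `x` at `h` and `x'` at `h + k`.
The element `k : Fin K` stands for the offset `k + 1`. -/
def multistep (M : ExBlockMDP X S Ξ A) (Θ : PMF (X → PMF A)) (H K : ℕ) [NeZero H]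
    (ω : PMF (Fin K)) : PMF (X × Fin K × X) :=
  (M.videoLaw Θ (H + K)).bind fun v =>
  (PMF.uniformOfFintype (Fin H)).bind fun h =>
  ω.map fun k => (v ⟨h, by omega⟩, k, v ⟨h + (k + 1), by omega⟩)

/-- Data for temporal contrastive learning: with `z` a fair coin, `(x, k, x', z)` is a causal pair
if `z` is true; otherwise `x'` is replaced by the first frame of an independent multistep
transition. -/
def contrastive (M : ExBlockMDP X S Ξ A) (Θ : PMF (X → PMF A)) (H K : ℕ) [NeZero H]
    (ω : PMF (Fin K)) : PMF (X × Fin K × X × Bool) :=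
  (M.multistep Θ H K ω).bind fun t =>
  (M.multistep Θ H K ω).bind fun u =>
  (PMF.uniformOfFintype Bool).map fun z => (t.1, t.2.1, if z then t.2.2 else u.1, z)

/-- The probability of the state `s` under the frame distribution of the videos. -/
def rho (M : ExBlockMDP X S Ξ A) (Θ : PMF (X → PMF A)) (H K : ℕ) [NeZero H]
    (ω : PMF (Fin K)) (s : S) : ℝ :=
  prob (M.multistep Θ H K ω) {t | M.decode t.1 = s}

/-- The conditional probability of the later frame `x'`, given the state of the first frame and
the offset. -/
def forwardProb (M : ExBlockMDP X S Ξ A) (Θ : PMF (X → PMF A)) (H K : ℕ) [NeZero H]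
    (ω : PMF (Fin K)) (s : S) (k : Fin K) (x' : X) : ℝ :=
  prob (M.multistep Θ H K ω) {t | M.decode t.1 = s ∧ t.2.1 = k ∧ t.2.2 = x'} /
    prob (M.multistep Θ H K ω) {t | M.decode t.1 = s ∧ t.2.1 = k}

/-- The conditional probability that the pair is causal, given the state of the first frame, the
offset, and the state of the second frame. -/
def causalProb (M : ExBlockMDP X S Ξ A) (Θ : PMF (X → PMF A)) (H K : ℕ) [NeZero H]
    (ω : PMF (Fin K)) (s : S) (k : Fin K) (s' : S) : ℝ :=
  prob (M.contrastive Θ H K ω)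
      {t | M.decode t.1 = s ∧ t.2.1 = k ∧ M.decode t.2.2.1 = s' ∧ t.2.2.2 = true} /
    prob (M.contrastive Θ H K ω) {t | M.decode t.1 = s ∧ t.2.1 = k ∧ M.decode t.2.2.1 = s'}

/-- The margin of forward modeling. -/
def forwardMargin (M : ExBlockMDP X S Ξ A) (Θ : PMF (X → PMF A)) (H K : ℕ) [NeZero H]
    (ω : PMF (Fin K)) : ℝ :=
  ⨅ p : {p : S × S // p.1 ≠ p.2}, expect ω fun k =>
    tvDist (M.forwardProb Θ H K ω p.1.1 k) (M.forwardProb Θ H K ω p.1.2 k)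

/-- The margin of temporal contrastive learning. -/
def temporalMargin [Fintype S] (M : ExBlockMDP X S Ξ A) (Θ : PMF (X → PMF A)) (H K : ℕ)
    [NeZero H] (ω : PMF (Fin K)) : ℝ :=
  ⨅ p : {p : S × S // p.1 ≠ p.2}, (1 / 2) * expect ω fun k => ∑ s' : S, M.rho Θ H K ω s' *
    |M.causalProb Θ H K ω p.1.1 k s' - M.causalProb Θ H K ω p.1.2 k s'|

/-- Both margins are positive.  All states occur in the videos, so that the conditional
probabilities in the margins make sense. -/
def Margin [Fintype S] (M : ExBlockMDP X S Ξ A) (Θ : PMF (X → PMF A)) (H K : ℕ) [NeZero H]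
    (ω : PMF (Fin K)) : Prop :=
  (∀ s, 0 < M.rho Θ H K ω s) ∧ 0 < M.forwardMargin Θ H K ω ∧ 0 < M.temporalMargin Θ H K ω

/-- The law of the decoder that the (randomized) algorithm `A₁` learns from `n` independent
videos of `T` frames. -/
def decoderLaw (M : ExBlockMDP X S Ξ A) (Θ : PMF (X → PMF A)) (n T : ℕ) {Φ : Type}
    (A₁ : (Fin n → Fin T → X) → PMF Φ) : PMF Φ :=
  (iid (M.videoLaw Θ T) n).bind A₁

end ExBlockMDP

/-- A class of Ex-Block MDPs is PAC learnable with `N` episodes: one online algorithm, which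
sees observations, actions and rewards of `N` episodes, returns an `ε`-optimal policy with
probability at least `1 - δ` on each member of the class. -/
def PACLearnable {X S Ξ A : Type} (𝓒 : Set (ExBlockMDP X S Ξ A)) (H N : ℕ) (ε δ : ℝ) : Prop :=
  ∃ alg : OnlineAlg X A H, ∀ M ∈ 𝓒,
    1 - δ ≤ prob (M.outputLaw H N (fun _ x => x) alg) {π | M.optValue H - M.value H π ≤ ε}

/-- The policy on observations given by an abstract policy and a decoder. -/
def compose {X O A : Type} {H : ℕ} (ψ : Fin H → O → A) (φ : Fin H → X → O) : Fin H → X → A :=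
  fun h x => ψ h (φ h x)

end

end VideoRL

open VideoRL

open VideoRL

namespace VideoRL

/-! ### Discrete distributions. -/

section Discrete

variable {α β : Type*}

/-! Hide the endogenous state among many indistinguishable coordinates. An observation shows a clock
and a vector of `d + 1` independent uniform states that stays fixed during the episode. One
coordinate `i` is endogenous, the others are noise, and only the reward depends on `i`. Videos
contain no rewards, so their law is the same for every `i` (`staticMDP.videoLaw_eq`). Since the
vector is frozen, a later frame reveals the earlier state, and both margins are positive.

A decoder learned from videos must therefore serve all `i` at once. Let `f` split the states almost
evenly between two actions. The centered indicators of `f (w i) = a`, one for each `i`, are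
orthogonal, so by Bessel's inequality a partition into `L` cells correlates noticeably with only
O(`L`) of them (`ncard_correlation_le`). For the other coordinates every policy on the cells loses a
constant already at the first step (`staticMDP.ncard_solvable_le`). With `d` of order `2 ^ (1 /
(4ε)) / δ`, averaging over `i` yields an instance on which the decoder is useless with high
probability (`staticMDP.exists_prob_decoder_ge`), whatever happens online.

With rewards, in contrast, `i` is found by elimination: under the constant action `a`, each episode
exposes a given wrong coordinate with probability at least 4/9. A union bound makes about `log d +
log (1 / δ')` episodes sufficient, which is linear in `1 / ε` and in the logarithms
(`staticMDP.one_sub_le_prob_learner`). -/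

lemma prob_nonneg (p : PMF α) (E : Set α) : 0 ≤ prob p E := ENNReal.toReal_nonneg

lemma toOuterMeasure_ne_top (p : PMF α) (E : Set α) : p.toOuterMeasure E ≠ ⊤ := by
  refine ne_top_of_le_ne_top ENNReal.one_ne_top ?_
  rw [PMF.toOuterMeasure_apply, ← p.tsum_coe]
  exact ENNReal.tsum_le_tsum fun a => Set.indicator_le_self _ _ a

lemma prob_mono_support (p : PMF α) {E F : Set α} (h : E ∩ p.support ⊆ F) :
    prob p E ≤ prob p F :=
  ENNReal.toReal_mono (toOuterMeasure_ne_top p F) (p.toOuterMeasure_mono h)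

lemma prob_pos {p : PMF α} {E : Set α} {a : α} (ha : a ∈ p.support) (hE : a ∈ E) :
    0 < prob p E := by
  refine ENNReal.toReal_pos (fun h => ?_) (toOuterMeasure_ne_top p E)
  rw [PMF.toOuterMeasure_apply_eq_zero_iff] at h
  exact Set.disjoint_left.1 h ha hE

lemma prob_eq_zero {p : PMF α} {E : Set α} (h : ∀ a ∈ p.support, a ∉ E) : prob p E = 0 := by
  rw [prob, (PMF.toOuterMeasure_apply_eq_zero_iff p _).2 (Set.disjoint_left.2 h), ENNReal.toReal_zero]

lemma prob_eq_sum [Fintype α] [DecidableEq α] (p : PMF α) (E : Set α) [DecidablePred (· ∈ E)] :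
    prob p E = ∑ a, (p a).toReal * if a ∈ E then 1 else 0 := by
  rw [prob, PMF.toOuterMeasure_apply_fintype, ENNReal.toReal_sum]
  · refine Finset.sum_congr rfl fun a _ => ?_
    by_cases ha : a ∈ E <;> simp [ha]
  · intro a _
    by_cases ha : a ∈ E <;> simp [ha, p.apply_ne_top]

lemma sum_toReal_eq_one [Fintype α] (p : PMF α) : ∑ a, (p a).toReal = 1 := by
  rw [← ENNReal.toReal_sum fun a _ => p.apply_ne_top a, ← tsum_fintype (L := .unconditional _),
    p.tsum_coe, ENNReal.toReal_one]

lemma prob_compl (p : PMF α) (E : Set α) : prob p Eᶜ = 1 - prob p E := by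
  have h : p.toOuterMeasure E + p.toOuterMeasure Eᶜ = 1 := by
    rw [PMF.toOuterMeasure_apply, PMF.toOuterMeasure_apply, ← ENNReal.tsum_add, ← p.tsum_coe]
    refine tsum_congr fun a => ?_
    by_cases ha : a ∈ E <;> simp [ha]
  have h' := congrArg ENNReal.toReal h
  rw [ENNReal.toReal_add (toOuterMeasure_ne_top _ _) (toOuterMeasure_ne_top _ _),
    ENNReal.toReal_one] at h'
  rw [prob, prob]
  linarith

lemma prob_map (p : PMF α) (f : α → β) (E : Set β) : prob (p.map f) E = prob p (f ⁻¹' E) := by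
  rw [prob, prob, PMF.toOuterMeasure_map_apply]

lemma prob_le_prob_bind (p : PMF α) (g : α → PMF β) {F : Set α} {E : Set β}
    (h : ∀ a ∈ F, (g a).support ⊆ E) : prob p F ≤ prob (p.bind g) E := by
  refine ENNReal.toReal_mono (toOuterMeasure_ne_top _ _) ?_
  rw [PMF.toOuterMeasure_bind_apply, PMF.toOuterMeasure_apply]
  refine ENNReal.tsum_le_tsum fun a => ?_
  by_cases ha : a ∈ F
  · rw [Set.indicator_of_mem ha, ((g a).toOuterMeasure_apply_eq_one_iff _).2 (h a ha), mul_one]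
  · rw [Set.indicator_of_notMem ha]
    exact zero_le

lemma prob_uniform [Fintype α] [Nonempty α] (E : Set α) [DecidablePred (· ∈ E)] :
    prob (PMF.uniformOfFintype α) E = (∑ a, if a ∈ E then (1 : ℝ) else 0) / Fintype.card α := by
  classical
  rw [prob_eq_sum, Finset.sum_div]
  refine Finset.sum_congr rfl fun a _ => ?_
  simp [div_eq_inv_mul]

/-- Rollouts of the static process are identified through their support alone, without computing any
probability. -/
lemma eq_pure_of_support_subset {p : PMF α} {a : α} (h : ∀ b ∈ p.support, b = a) :
    p = PMF.pure a := by
  have hs : p.support = {a} := by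
    obtain ⟨b, hb⟩ := p.support_nonempty
    refine Set.eq_singleton_iff_unique_mem.2 ⟨?_, h⟩
    rw [← h b hb]
    exact hb
  refine PMF.ext fun b => ?_
  by_cases hb : b = a
  · subst hb
    rw [(p.apply_eq_one_iff b).2 hs]
    simp
  · rw [(p.apply_eq_zero_iff b).2 fun hb' => hb (h b hb')]
    simp [hb]

lemma uniform_prod [Fintype α] [Nonempty α] [Fintype β] [Nonempty β] :
    ((PMF.uniformOfFintype α).bind fun a => (PMF.uniformOfFintype β).map fun b => (a, b)) =
      PMF.uniformOfFintype (α × β) := by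
  classical
  refine PMF.ext fun ⟨a, b⟩ => ?_
  rw [PMF.bind_apply, tsum_eq_single a]
  · rw [PMF.map_apply, tsum_eq_single b]
    · simp only [PMF.uniformOfFintype_apply, Fintype.card_prod, if_true, Nat.cast_mul]
      rw [ENNReal.mul_inv] <;> simp
    · intro b' hb
      simp [hb.symm]
  · intro a' ha
    simp [PMF.map_apply, ha.symm]

lemma uniform_map_equiv [Fintype α] [Nonempty α] [Fintype β] [Nonempty β] (e : α ≃ β) :
    (PMF.uniformOfFintype α).map e = PMF.uniformOfFintype β := by
  classical
  refine PMF.ext fun b => ?_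
  rw [PMF.map_apply, tsum_eq_single (e.symm b)]
  · simp [Fintype.card_congr e]
  · intro a ha
    rw [if_neg]
    rintro rfl
    simp at ha

lemma expect_fintype [Fintype α] (p : PMF α) (f : α → ℝ) :
    expect p f = ∑ a, (p a).toReal * f a := tsum_fintype _

lemma expect_map [Fintype α] (p : PMF α) (g : α → β) (f : β → ℝ) :
    expect (p.map g) f = ∑ a, (p a).toReal * f (g a) := by
  classical
  have h : ∀ b, ((p.map g) b).toReal * f b =
      ∑ a, if b = g a then (p a).toReal * f (g a) else 0 := by
    intro b
    rw [PMF.map_apply, tsum_fintype, ENNReal.toReal_sum, Finset.sum_mul]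
    · refine Finset.sum_congr rfl fun a _ => ?_
      by_cases hb : b = g a <;> simp [hb]
    · intro a _
      by_cases hb : b = g a <;> simp [hb, p.apply_ne_top]
  rw [expect, tsum_congr h, Summable.tsum_finsetSum]
  · refine Finset.sum_congr rfl fun a _ => ?_
    rw [tsum_ite_eq]
  · intro a _
    exact (hasSum_ite_eq (g a) _).summable

lemma expect_pos [Fintype α] {p : PMF α} {f : α → ℝ} (hf : ∀ a, 0 ≤ f a)
    (h : ∀ a ∈ p.support, 0 < f a) : 0 < expect p f := by
  obtain ⟨a, ha⟩ := p.support_nonempty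
  rw [expect_fintype]
  refine Finset.sum_pos' (fun b _ => mul_nonneg ENNReal.toReal_nonneg (hf b))
    ⟨a, Finset.mem_univ a, mul_pos ?_ (h a ha)⟩
  exact ENNReal.toReal_pos ((p.mem_support_iff a).1 ha) (p.apply_ne_top a)

/-- Markov's inequality for the gap between a bounded function and its upper bound. -/
lemma expect_le_of_prob [Fintype α] (p : PMF α) {f : α → ℝ} {m c : ℝ} (hf : ∀ a, f a ≤ m) :
    c * prob p {a | c ≤ m - f a} ≤ m - expect p f := by
  classical
  have hm : m = ∑ a, (p a).toReal * m := by
    rw [← Finset.sum_mul, sum_toReal_eq_one, one_mul]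
  rw [expect_fintype, prob_eq_sum, Finset.mul_sum, hm, ← Finset.sum_sub_distrib]
  rw [← hm]
  refine Finset.sum_le_sum fun a _ => ?_
  have hp : 0 ≤ (p a).toReal := ENNReal.toReal_nonneg
  by_cases ha : c ≤ m - f a
  · simp only [Set.mem_ofPred_eq, ha, if_true]
    nlinarith
  · simp only [Set.mem_ofPred_eq, ha, if_false]
    nlinarith [hf a]

/-- Double counting: the probabilities of the `E i` add up to the expected number of events that
occur, so the smallest of them is at most the average. -/
lemma exists_prob_le {ι : Type*} [Fintype ι] [Nonempty ι] [Fintype α] (p : PMF α)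
    (E : ι → Set α) {m : ℝ} (h : ∀ a, (({i | a ∈ E i} : Set ι).ncard : ℝ) ≤ m) :
    ∃ i, prob p (E i) * Fintype.card ι ≤ m := by
  classical
  by_contra! hc
  have h₁ : ∑ i, prob p (E i) ≤ m := by
    calc ∑ i, prob p (E i) = ∑ a, (p a).toReal * ∑ i, if a ∈ E i then (1 : ℝ) else 0 := by
          simp_rw [prob_eq_sum, Finset.mul_sum]
          exact Finset.sum_comm
      _ ≤ ∑ a, (p a).toReal * m := by
          refine Finset.sum_le_sum fun a _ =>
            mul_le_mul_of_nonneg_left ?_ ENNReal.toReal_nonneg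
          refine le_trans (le_of_eq ?_) (h a)
          rw [Finset.sum_boole, Set.ncard_eq_toFinset_card']
          congr 2
          ext i
          simp
      _ = m := by rw [← Finset.sum_mul, sum_toReal_eq_one, one_mul]
  have hcard : (0 : ℝ) < Fintype.card ι := by exact_mod_cast Fintype.card_pos
  have h₂ : ∑ _i : ι, m / Fintype.card ι < ∑ i, prob p (E i) :=
    Finset.sum_lt_sum_of_nonempty Finset.univ_nonempty fun i _ => by
      rw [div_lt_iff₀ hcard]
      exact hc i
  rw [Finset.sum_const, Finset.card_univ, nsmul_eq_mul, mul_div_cancel₀ _ hcard.ne'] at h₂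
  linarith

lemma prob_iUnion_le {ι : Type*} [Fintype ι] (p : PMF α) (E : ι → Set α) {q : ℝ}
    (h : ∀ i, prob p (E i) ≤ q) : prob p (⋃ i, E i) ≤ Fintype.card ι * q := by
  have h₁ : p.toOuterMeasure (⋃ i, E i) ≤ ∑ i, p.toOuterMeasure (E i) := by
    rw [← tsum_fintype (L := .unconditional _)]
    exact MeasureTheory.measure_iUnion_le E
  have h₂ := ENNReal.toReal_mono
    (ENNReal.sum_ne_top.2 fun i _ => toOuterMeasure_ne_top p (E i)) h₁
  rw [ENNReal.toReal_sum fun i _ => toOuterMeasure_ne_top p (E i)] at h₂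
  refine h₂.trans ((Finset.sum_le_sum fun i _ => h i).trans ?_)
  rw [Finset.sum_const, Finset.card_univ, nsmul_eq_mul]

end Discrete

/-- The probability that all episodes of a non-adaptive algorithm lie in a given set. -/
lemma interact_all_le {X S Ξ A O : Type} (M : ExBlockMDP X S Ξ A) (H : ℕ) (φ : Fin H → X → O)
    (alg : OnlineAlg O A H) (G : Set (Episode O A H)) {q : ℝ}
    (hq : ∀ past, prob (M.episode H φ (alg.act past)) G ≤ q) (N : ℕ) :
    prob (M.interact H φ alg N []) {l | ∀ τ ∈ l, τ ∈ G} ≤ q ^ N := by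
  classical
  have hq0 : 0 ≤ q := (prob_nonneg _ _).trans (hq [])
  have hq' : ∀ past, (M.episode H φ (alg.act past)).toOuterMeasure G ≤ ENNReal.ofReal q :=
    fun past => (ENNReal.le_ofReal_iff_toReal_le (toOuterMeasure_ne_top _ _) hq0).2 (hq past)
  -- The bound `hq'`, uniform in the past, replaces independence. The list `past` must vary in the
  -- induction; one bad element in it already excludes the event.
  have key : ∀ N past, (M.interact H φ alg N past).toOuterMeasure {l | ∀ τ ∈ l, τ ∈ G} ≤
      if ∀ τ ∈ past, τ ∈ G then ENNReal.ofReal q ^ N else 0 := by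
    intro N
    induction N with
    | zero =>
      intro past
      simp only [ExBlockMDP.interact, PMF.toOuterMeasure_pure_apply, pow_zero]
      refine le_of_eq ?_
      congr
    | succ N ih =>
      intro past
      rw [ExBlockMDP.interact, PMF.toOuterMeasure_bind_apply]
      refine (ENNReal.tsum_le_tsum fun τ => mul_le_mul_right (ih (past ++ [τ])) _).trans ?_
      by_cases hp : ∀ τ ∈ past, τ ∈ G
      · rw [if_pos hp, pow_succ']
        refine le_trans (le_of_eq ?_) (mul_le_mul_left (hq' past) _)
        rw [PMF.toOuterMeasure_apply, ← ENNReal.tsum_mul_right]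
        refine tsum_congr fun τ => ?_
        by_cases hτ : τ ∈ G
        · rw [if_pos, Set.indicator_of_mem hτ]
          intro σ hσ
          rcases List.mem_append.1 hσ with h | h
          · exact hp σ h
          · rw [List.mem_singleton.1 h]
            exact hτ
        · rw [if_neg, Set.indicator_of_notMem hτ, mul_zero, zero_mul]
          exact fun h => hτ (h τ (by simp))
      · rw [if_neg hp]
        refine le_of_eq (ENNReal.tsum_eq_zero.2 fun τ => ?_)
        rw [if_neg, mul_zero]
        exact fun h => hp fun σ hσ => h σ (List.mem_append_left _ hσ)
  have h := key N []
  rw [if_pos (by simp)] at h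
  rw [prob]
  refine (ENNReal.toReal_mono (by simp) h).trans ?_
  rw [ENNReal.toReal_pow, ENNReal.toReal_ofReal hq0]

end VideoRL

/-! ### The hard instances and their videos. -/

namespace VideoRL

noncomputable section

open Classical in
/-- An Ex-Block MDP without dynamics.  An observation consists of the time, modulo `T`, and of a
vector of `d + 1` states that is uniformly distributed and constant during an episode.  The
endogenous state is the coordinate `i` of this vector; the reward is `1` for the action
`f s` and `0` for all other actions. -/
def staticMDP {S A : Type} [Fintype S] [Nonempty S] (T : ℕ) [NeZero T] (d : ℕ) (f : S → A)
    (i : Fin (d + 1)) : ExBlockMDP (Fin T × (Fin (d + 1) → S)) S (Fin T × (Fin d → S)) A where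
  init := PMF.uniformOfFintype S
  initExo := (PMF.uniformOfFintype (Fin d → S)).map fun y => (Fin.ofNat T 0, y)
  trans s _ := PMF.pure s
  -- The clock is part of the noise, so frames encode time although the vector never moves.
  transExo ξ := PMF.pure (Fin.ofNat T (ξ.1 + 1), ξ.2)
  emit s ξ := PMF.pure (ξ.1, i.insertNth (α := fun _ => S) s ξ.2)
  reward s a := if a = f s then 1 else 0
  reward_mem s a := by split_ifs <;> simp
  decode x := x.2 i
  decodeExo x := (x.1, i.removeNth x.2)
  decode_emit s ξ x hx := by
    rw [PMF.mem_support_pure_iff] at hx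
    subst hx
    simp

namespace staticMDP

variable {S A : Type} [Fintype S] [Nonempty S] {T : ℕ} [NeZero T] {d : ℕ} {f : S → A}
  {i : Fin (d + 1)}

open Classical in
lemma reward_apply (s : S) (a : A) :
    (staticMDP T d f i).reward s a = if a = f s then 1 else 0 := rfl

lemma reward_le_one (s : S) (a : A) : (staticMDP T d f i).reward s a ≤ 1 :=
  ((staticMDP T d f i).reward_mem s a).2

/-- The observation at step `h`. -/
def frame (T : ℕ) [NeZero T] (w : Fin (d + 1) → S) (h : ℕ) : Fin T × (Fin (d + 1) → S) :=
  (Fin.ofNat T h, w)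

/-- The history is left existential because it never matters: the agents to which the action clause
is applied ignore it. -/
lemma rollout_support (n : ℕ) (π : Agent (Fin T × (Fin (d + 1) → S)) A n) (s : S)
    (t : Fin T) (y : Fin d → S) :
    ∀ τ ∈ ((staticMDP T d f i).rollout n (fun _ x => x) π s (t, y)).support, ∀ h : Fin n,
      (τ h).1 = frame T (i.insertNth (α := fun _ => S) s y) (t + h) ∧
      (τ h).2.2 = (staticMDP T d f i).reward s (τ h).2.1 ∧
      ∃ past, (τ h).2.1 ∈ (π h past (τ h).1).support := by
  induction n generalizing t with
  | zero => exact fun _ _ h => h.elim0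
  | succ n ih =>
    intro τ hτ
    simp only [ExBlockMDP.rollout, PMF.mem_support_bind_iff, PMF.support_map] at hτ
    obtain ⟨x, hx, a, ha, s', hs', ξ', hξ', τ', hτ', rfl⟩ := hτ
    simp only [staticMDP, PMF.mem_support_pure_iff] at hx hs' hξ'
    subst hx hs' hξ'
    intro h
    refine Fin.cases ?_ (fun h => ?_) h
    · refine ⟨?_, rfl, [], ha⟩
      refine Prod.ext (Fin.ext ?_) rfl
      simp [frame]
    · obtain ⟨h₁, h₂, past, h₃⟩ := ih _ _ τ' hτ' h
      refine ⟨h₁.trans (Prod.ext (Fin.ext ?_) rfl), h₂, _, h₃⟩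
      simp [frame, add_assoc, add_comm 1]

/-- Averaging over the initial latent variables amounts to averaging over the vector. -/
lemma init_bind {β : Type} (g : (Fin (d + 1) → S) → PMF β)
    (G : S → Fin T × (Fin d → S) → PMF β)
    (hG : ∀ s y, G s (Fin.ofNat T 0, y) = g (i.insertNth (α := fun _ => S) s y)) :
    ((staticMDP T d f i).init.bind fun s => (staticMDP T d f i).initExo.bind fun ξ => G s ξ) =
      (PMF.uniformOfFintype (Fin (d + 1) → S)).bind g := by
  -- Inserting a uniform state at any position of a uniform vector gives a uniform vector; this is
  -- what conceals `i`.
  rw [← uniform_map_equiv (Fin.insertNthEquiv (fun _ => S) i), PMF.bind_map, ← uniform_prod,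
    PMF.bind_bind]
  simp only [staticMDP, PMF.bind_map]
  refine congrArg _ (funext fun s => congrArg _ (funext fun y => ?_))
  exact hG s y

/-- The episode of a deterministic policy, as a function of the vector. -/
def detEpisode (T : ℕ) [NeZero T] (f : S → A) (i : Fin (d + 1)) {n : ℕ}
    (π : Fin n → Fin T × (Fin (d + 1) → S) → A) (w : Fin (d + 1) → S) :
    Episode (Fin T × (Fin (d + 1) → S)) A n :=
  fun h => (frame T w h, π h (frame T w h),
    (staticMDP T d f i).reward (w i) (π h (frame T w h)))

lemma rawEpisode_detAgent {n : ℕ} (π : Fin n → Fin T × (Fin (d + 1) → S) → A) :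
    (staticMDP T d f i).rawEpisode n (detAgent π) =
      (PMF.uniformOfFintype (Fin (d + 1) → S)).map (detEpisode T f i π) := by
  refine init_bind (fun w => PMF.pure (detEpisode T f i π w)) _ fun s y => ?_
  refine eq_pure_of_support_subset fun τ hτ => funext fun h => ?_
  obtain ⟨h₁, h₂, past, h₃⟩ := rollout_support n _ s _ y τ hτ h
  rw [detAgent, PMF.mem_support_pure_iff, h₁] at h₃
  simp only [Fin.val_ofNat, Nat.zero_mod, zero_add] at h₁ h₃
  refine Prod.ext h₁ (Prod.ext h₃ ?_)
  rw [h₂, h₃, detEpisode, Fin.insertNth_apply_same]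

lemma rawEpisode_support {n : ℕ} (π : Agent (Fin T × (Fin (d + 1) → S)) A n) :
    ∀ τ ∈ ((staticMDP T d f i).rawEpisode n π).support, ∃ w, ∀ h : Fin n,
      (τ h).1 = frame T w h := by
  intro τ hτ
  simp only [ExBlockMDP.rawEpisode, ExBlockMDP.episode, PMF.mem_support_bind_iff] at hτ
  obtain ⟨s, -, ξ, hξ, hτ⟩ := hτ
  simp only [staticMDP, PMF.mem_support_map_iff] at hξ
  obtain ⟨y, -, rfl⟩ := hξ
  refine ⟨i.insertNth (α := fun _ => S) s y, fun h => ((rollout_support n π s _ y τ hτ h).1).trans ?_⟩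
  simp

/-- Actions influence neither the state nor the noise, and a video omits actions and rewards. The
right-hand side contains neither `i` nor `f` nor `Θ`: videos carry no information about the
instance. -/
lemma videoLaw_eq (Θ : PMF (Fin T × (Fin (d + 1) → S) → PMF A)) (n : ℕ) :
    (staticMDP T d f i).videoLaw Θ n =
      (PMF.uniformOfFintype (Fin (d + 1) → S)).map fun w (h : Fin n) => frame T w h := by
  have key : ∀ π : Fin T × (Fin (d + 1) → S) → PMF A,
      ((staticMDP T d f i).rawEpisode n (stationaryAgent n π)).map (fun τ h => (τ h).1) =
        (PMF.uniformOfFintype (Fin (d + 1) → S)).map fun w (h : Fin n) => frame T w h := by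
    intro π
    simp only [ExBlockMDP.rawEpisode, ExBlockMDP.episode, PMF.map_bind]
    refine init_bind (fun w => PMF.pure fun h : Fin n => frame T w h) _ fun s y => ?_
    refine eq_pure_of_support_subset fun v hv => funext fun h => ?_
    obtain ⟨τ, hτ, rfl⟩ := (PMF.mem_support_map_iff _ _ _).1 hv
    simpa using (rollout_support n _ s _ y τ hτ h).1
  rw [ExBlockMDP.videoLaw]
  simp_rw [key]
  exact PMF.bind_const _ _

lemma encodesTime {n : ℕ} (hn : n ≤ T) : (staticMDP T d f i).EncodesTime n := by
  refine ⟨fun x => x.1, fun π τ hτ h => ?_⟩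
  obtain ⟨w, hw⟩ := rawEpisode_support π τ hτ
  rw [hw h]
  exact Nat.mod_eq_of_lt (h.2.trans_le hn)

lemma frame_mem_videoLaw (Θ : PMF (Fin T × (Fin (d + 1) → S) → PMF A)) {n : ℕ}
    (w : Fin (d + 1) → S) :
    (fun h : Fin n => frame T w h) ∈ ((staticMDP T d f i).videoLaw Θ n).support := by
  rw [videoLaw_eq, PMF.mem_support_map_iff]
  exact ⟨w, by simp, rfl⟩

lemma dataCollection (σ : PMF A) {H : ℕ} (hH : 0 < H) :
    (staticMDP T d f i).DataCollection (PMF.pure fun _ => σ) H := by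
  refine ⟨?_, fun π hπ => ⟨fun _ => σ, fun x => ?_⟩⟩
  · have : Nonempty (Fin H) := ⟨⟨0, hH⟩⟩
    obtain ⟨p, hp⟩ := Finite.exists_min fun p : Fin H × S =>
      prob ((staticMDP T d f i).videoLaw (PMF.pure fun _ => σ) H)
        {v | (staticMDP T d f i).decode (v p.1) = p.2}
    refine ⟨_, ?_, fun h s _ => hp (h, s)⟩
    -- Constant vectors show that every state occurs at every step, so the least of the finitely
    -- many probabilities can serve as `η` without regard to reachability.
    exact prob_pos (frame_mem_videoLaw _ fun _ => p.2) rfl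
  · rw [PMF.mem_support_pure_iff] at hπ
    rw [hπ]

lemma mem_multistep (Θ : PMF (Fin T × (Fin (d + 1) → S) → PMF A)) {H K : ℕ} [NeZero H]
    (ω : PMF (Fin K)) (t : (Fin T × (Fin (d + 1) → S)) × Fin K × (Fin T × (Fin (d + 1) → S))) :
    t ∈ ((staticMDP T d f i).multistep Θ H K ω).support ↔
      ∃ w, ∃ h : Fin H, ∃ k ∈ ω.support, t = (frame T w h, k, frame T w (h + (k + 1))) := by
  simp only [ExBlockMDP.multistep, videoLaw_eq, PMF.bind_map, PMF.mem_support_bind_iff,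
    PMF.mem_support_map_iff, PMF.mem_support_uniformOfFintype, true_and, Function.comp]
  constructor
  · rintro ⟨w, h, k, hk, rfl⟩
    exact ⟨w, h, k, hk, rfl⟩
  · rintro ⟨w, h, k, hk, rfl⟩
    exact ⟨w, h, k, hk, rfl⟩

lemma rho_pos (Θ : PMF (Fin T × (Fin (d + 1) → S) → PMF A)) {H K : ℕ} [NeZero H]
    (ω : PMF (Fin K)) (s : S) : 0 < (staticMDP T d f i).rho Θ H K ω s := by
  obtain ⟨k, hk⟩ := ω.support_nonempty
  exact prob_pos ((mem_multistep Θ ω _).2 ⟨fun _ => s, 0, k, hk, rfl⟩) rfl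

/-- The later frame still contains coordinate `i`, so frames that can follow one state never follow
another. A single frame, with the constant vector `p.1.1`, suffices as a witness. -/
lemma forwardMargin_pos [Nontrivial S] (Θ : PMF (Fin T × (Fin (d + 1) → S) → PMF A)) {H K : ℕ}
    [NeZero H] (ω : PMF (Fin K)) : 0 < (staticMDP T d f i).forwardMargin Θ H K ω := by
  have : Nonempty {p : S × S // p.1 ≠ p.2} :=
    let ⟨a, b, h⟩ := exists_pair_ne S
    ⟨⟨(a, b), h⟩⟩
  obtain ⟨p, hp⟩ := exists_eq_ciInf_of_finite (f := fun p : {p : S × S // p.1 ≠ p.2} =>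
    expect ω fun k => tvDist ((staticMDP T d f i).forwardProb Θ H K ω p.1.1 k)
      ((staticMDP T d f i).forwardProb Θ H K ω p.1.2 k))
  rw [ExBlockMDP.forwardMargin, ← hp]
  refine expect_pos (fun k => ?_) fun k hk => ?_
  · rw [tvDist, tsum_fintype]
    positivity
  · rw [tvDist, tsum_fintype]
    refine mul_pos (by norm_num) (Finset.sum_pos' (fun _ _ => abs_nonneg _)
      ⟨frame T (fun _ => p.1.1) (0 + (k + 1)), Finset.mem_univ _, ?_⟩)
    have hmem := (mem_multistep (f := f) (i := i) Θ ω _).2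
      ⟨fun _ => p.1.1, (0 : Fin H), k, hk, rfl⟩
    have h₁ : 0 < (staticMDP T d f i).forwardProb Θ H K ω p.1.1 k
        (frame T (fun _ => p.1.1) (0 + (k + 1))) := by
      refine div_pos (prob_pos hmem ⟨rfl, rfl, ?_⟩) (prob_pos hmem ⟨rfl, rfl⟩)
      simp
    have h₂ : (staticMDP T d f i).forwardProb Θ H K ω p.1.2 k
        (frame T (fun _ => p.1.1) (0 + (k + 1))) = 0 := by
      rw [ExBlockMDP.forwardProb, prob_eq_zero, zero_div]
      rintro t ht ⟨ht₁, -, ht₂⟩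
      obtain ⟨w, h, k', -, rfl⟩ := (mem_multistep Θ ω _).1 ht
      have hw : w = fun _ => p.1.1 := congrArg Prod.snd ht₂
      subst hw
      exact p.2 ht₁
    rw [h₂, sub_zero]
    exact abs_pos_of_pos h₁

lemma mem_contrastive (Θ : PMF (Fin T × (Fin (d + 1) → S) → PMF A)) {H K : ℕ} [NeZero H]
    (ω : PMF (Fin K))
    (t : (Fin T × (Fin (d + 1) → S)) × Fin K × (Fin T × (Fin (d + 1) → S)) × Bool)
    (ht : t.2.2.2 = true) :
    t ∈ ((staticMDP T d f i).contrastive Θ H K ω).support ↔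
      ∃ w, ∃ h : Fin H, ∃ k ∈ ω.support, t = (frame T w h, k, frame T w (h + (k + 1)), true) := by
  simp only [ExBlockMDP.contrastive, PMF.mem_support_bind_iff,
    PMF.mem_support_map_iff, PMF.mem_support_uniformOfFintype, true_and]
  constructor
  · rintro ⟨t', ht', u, -, z, rfl⟩
    obtain ⟨w, h, k, hk, rfl⟩ := (mem_multistep Θ ω _).1 ht'
    simp only at ht
    subst ht
    exact ⟨w, h, k, hk, rfl⟩
  · rintro ⟨w, h, k, hk, rfl⟩
    have hm := (mem_multistep (f := f) (i := i) Θ ω _).2 ⟨w, h, k, hk, rfl⟩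
    -- The independent transition is discarded when `z` is true, so the same one may be reused.
    exact ⟨_, hm, _, hm, true, rfl⟩

/-- In a causal pair both states agree. Hence the second state `p.1.1` is never causal after
`p.1.2`, but is so with positive probability after itself. -/
lemma temporalMargin_pos [Nontrivial S] (Θ : PMF (Fin T × (Fin (d + 1) → S) → PMF A)) {H K : ℕ}
    [NeZero H] (ω : PMF (Fin K)) : 0 < (staticMDP T d f i).temporalMargin Θ H K ω := by
  have : Nonempty {p : S × S // p.1 ≠ p.2} :=
    let ⟨a, b, h⟩ := exists_pair_ne S
    ⟨⟨(a, b), h⟩⟩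
  obtain ⟨p, hp⟩ := exists_eq_ciInf_of_finite (f := fun p : {p : S × S // p.1 ≠ p.2} =>
    (1 / 2) * expect ω fun k => ∑ s' : S, (staticMDP T d f i).rho Θ H K ω s' *
      |(staticMDP T d f i).causalProb Θ H K ω p.1.1 k s' -
        (staticMDP T d f i).causalProb Θ H K ω p.1.2 k s'|)
  rw [ExBlockMDP.temporalMargin, ← hp]
  have hnn : ∀ (k : Fin K) (s' : S), 0 ≤ (staticMDP T d f i).rho Θ H K ω s' *
      |(staticMDP T d f i).causalProb Θ H K ω p.1.1 k s' -
        (staticMDP T d f i).causalProb Θ H K ω p.1.2 k s'| :=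
    fun k s' => mul_nonneg (rho_pos Θ ω s').le (abs_nonneg _)
  refine mul_pos (by norm_num) (expect_pos (fun k => Finset.sum_nonneg fun s' _ => hnn k s')
    fun k hk => Finset.sum_pos' (fun s' _ => hnn k s') ⟨p.1.1, Finset.mem_univ _,
      mul_pos (rho_pos Θ ω _) ?_⟩)
  have hmem := (mem_contrastive (f := f) (i := i) Θ ω _ rfl).2
    ⟨fun _ => p.1.1, (0 : Fin H), k, hk, rfl⟩
  have h₁ : 0 < (staticMDP T d f i).causalProb Θ H K ω p.1.1 k p.1.1 :=
    div_pos (prob_pos hmem ⟨rfl, rfl, rfl, rfl⟩) (prob_pos hmem ⟨rfl, rfl, rfl⟩)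
  have h₂ : (staticMDP T d f i).causalProb Θ H K ω p.1.2 k p.1.1 = 0 := by
    rw [ExBlockMDP.causalProb, prob_eq_zero, zero_div]
    rintro t ht ⟨ht₁, -, ht₂, ht₃⟩
    obtain ⟨w, h, k', -, rfl⟩ := (mem_contrastive Θ ω _ ht₃).1 ht
    exact p.2 (ht₂.symm.trans ht₁)
  rw [h₂, sub_zero]
  exact abs_pos_of_pos h₁

lemma margin [Nontrivial S] (Θ : PMF (Fin T × (Fin (d + 1) → S) → PMF A)) {H K : ℕ}
    [NeZero H] (ω : PMF (Fin K)) : (staticMDP T d f i).Margin Θ H K ω :=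
  ⟨rho_pos Θ ω, forwardMargin_pos Θ ω, temporalMargin_pos Θ ω⟩

lemma value_eq {H : ℕ} (π : Fin H → Fin T × (Fin (d + 1) → S) → A) :
    (staticMDP T d f i).value H π =
      (∑ w : Fin (d + 1) → S, ∑ h : Fin H,
        (staticMDP T d f i).reward (w i) (π h (frame T w h))) /
          Fintype.card (Fin (d + 1) → S) := by
  rw [ExBlockMDP.value, rawEpisode_detAgent, expect_map, Finset.sum_div]
  refine Finset.sum_congr rfl fun w _ => ?_
  simp only [PMF.uniformOfFintype_apply, ENNReal.toReal_inv, ENNReal.toReal_natCast, detEpisode]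
  rw [div_eq_inv_mul]

lemma card_pos : (0 : ℝ) < Fintype.card (Fin (d + 1) → S) := by
  exact_mod_cast Fintype.card_pos

lemma value_le {H : ℕ} (π : Fin H → Fin T × (Fin (d + 1) → S) → A) :
    (staticMDP T d f i).value H π ≤ H := by
  rw [value_eq, div_le_iff₀ card_pos]
  calc ∑ w : Fin (d + 1) → S, ∑ h : Fin H, (staticMDP T d f i).reward (w i) (π h (frame T w h))
      ≤ ∑ _w : Fin (d + 1) → S, ∑ _h : Fin H, (1 : ℝ) :=
        Finset.sum_le_sum fun w _ => Finset.sum_le_sum fun h _ => reward_le_one _ _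
    _ = H * Fintype.card (Fin (d + 1) → S) := by simp [mul_comm]

lemma value_decode (H : ℕ) : (staticMDP T d f i).value H (fun _ x => f (x.2 i)) = H := by
  rw [value_eq, div_eq_iff card_pos.ne']
  simp [reward_apply, frame, mul_comm]

lemma optValue_eq (H : ℕ) : (staticMDP T d f i).optValue H = H := by
  have : Nonempty (Fin H → Fin T × (Fin (d + 1) → S) → A) := ⟨fun _ x => f (x.2 i)⟩
  refine le_antisymm (ciSup_le value_le) ?_
  rw [← value_decode (T := T) (f := f) (i := i) H]
  exact le_ciSup (f := fun π => (staticMDP T d f i).value H π)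
    ⟨H, by rintro _ ⟨π, rfl⟩; exact value_le π⟩ _

end staticMDP

end

end VideoRL

namespace VideoRL

/-! ### Partitions and orthogonal families. -/

section Correlation

/-- Bessel's inequality for an orthogonal family of functions of equal norms. -/
lemma sum_sq_le_of_orthogonal {ι W : Type*} [Fintype ι] [DecidableEq ι] [Fintype W]
    (b : ι → W → ℝ) {V : ℝ} (hb : ∀ i j, ∑ w, b i w * b j w = if i = j then V else 0)
    (hV : 0 < V) (g : W → ℝ) : ∑ i, (∑ w, g w * b i w) ^ 2 ≤ V * ∑ w, g w ^ 2 := by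
  set u : ι → ℝ := fun i => ∑ w, g w * b i w with hu
  have h₁ : ∑ w, g w * ∑ i, u i * b i w = ∑ i, u i ^ 2 := by
    simp_rw [Finset.mul_sum]
    rw [Finset.sum_comm]
    refine Finset.sum_congr rfl fun i _ => ?_
    rw [pow_two, hu, Finset.mul_sum]
    exact Finset.sum_congr rfl fun w _ => by ring
  have h₂ : ∑ w, (∑ i, u i * b i w) ^ 2 = V * ∑ i, u i ^ 2 := by
    simp_rw [pow_two, Finset.sum_mul_sum]
    rw [Finset.sum_comm, Finset.mul_sum]
    refine Finset.sum_congr rfl fun i _ => ?_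
    rw [Finset.sum_comm]
    have : ∀ j, ∑ w, u i * b i w * (u j * b j w) = u i * u j * if i = j then V else 0 := by
      intro j
      rw [← hb i j, Finset.mul_sum]
      exact Finset.sum_congr rfl fun w _ => by ring
    simp_rw [this]
    simp
    ring
  -- The residual of the projection of `g`, multiplied by `V` to avoid division.
  have h₃ : 0 ≤ ∑ w, (V * g w - ∑ i, u i * b i w) ^ 2 := Finset.sum_nonneg fun w _ => sq_nonneg _
  have h₄ : ∑ w, (V * g w - ∑ i, u i * b i w) ^ 2 =
      V ^ 2 * ∑ w, g w ^ 2 - 2 * V * ∑ w, g w * ∑ i, u i * b i w +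
        ∑ w, (∑ i, u i * b i w) ^ 2 := by
    rw [Finset.mul_sum, Finset.mul_sum, ← Finset.sum_sub_distrib, ← Finset.sum_add_distrib]
    exact Finset.sum_congr rfl fun w _ => by ring
  rw [h₄, h₁, h₂] at h₃
  refine le_of_mul_le_mul_left ?_ hV
  linarith

variable {ι W Λ : Type*} [Fintype W] [Fintype Λ] [DecidableEq Λ]

/-- The sum of the absolute correlations of `b` with the cells of the partition given by `g`. -/
def correlation (g : W → Λ) (b : W → ℝ) : ℝ :=
  ∑ l, |∑ w, (if g w = l then 1 else 0) * b w|

/-- A partition into few cells correlates with few members of an orthogonal family. -/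
lemma ncard_correlation_le [Fintype ι] [DecidableEq ι] (b : ι → W → ℝ) {V : ℝ}
    (hb : ∀ i j, ∑ w, b i w * b j w = if i = j then V else 0) (hV : 0 < V) (g : W → Λ)
    {c : ℝ} (hc : 0 ≤ c) :
    (({i | c < correlation g (b i)} : Set ι).ncard : ℝ) * c ^ 2 ≤
      Fintype.card Λ * (V * Fintype.card W) := by
  classical
  rw [Set.ncard_eq_toFinset_card']
  calc ((({i | c < correlation g (b i)} : Set ι).toFinset.card : ℕ) : ℝ) * c ^ 2
      = ∑ _i ∈ ({i | c < correlation g (b i)} : Set ι).toFinset, c ^ 2 := by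
        rw [Finset.sum_const, nsmul_eq_mul]
    _ ≤ ∑ i ∈ ({i | c < correlation g (b i)} : Set ι).toFinset, correlation g (b i) ^ 2 := by
        refine Finset.sum_le_sum fun i hi => pow_le_pow_left₀ hc ?_ 2
        have hi' : i ∈ {i | c < correlation g (b i)} := Set.mem_toFinset.1 hi
        exact le_of_lt hi'
    _ ≤ ∑ i, correlation g (b i) ^ 2 :=
        Finset.sum_le_univ_sum_of_nonneg fun i => sq_nonneg _
    _ ≤ ∑ i, Fintype.card Λ * ∑ l, (∑ w, (if g w = l then 1 else 0) * b i w) ^ 2 := by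
        -- Cauchy–Schwarz over the cells costs the factor `Fintype.card Λ`; afterwards Bessel
        -- applies to each cell indicator, and their squared norms add up to `Fintype.card W`.
        refine Finset.sum_le_sum fun i _ => ?_
        refine (sq_sum_le_card_mul_sum_sq (s := Finset.univ)).trans (le_of_eq ?_)
        simp only [sq_abs, Finset.card_univ]
    _ = Fintype.card Λ * ∑ l, ∑ i, (∑ w, (if g w = l then 1 else 0) * b i w) ^ 2 := by
        rw [← Finset.mul_sum, Finset.sum_comm]
    _ ≤ Fintype.card Λ * ∑ l, V * ∑ w, (if g w = l then (1 : ℝ) else 0) ^ 2 :=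
        mul_le_mul_of_nonneg_left
          (Finset.sum_le_sum fun l _ => sum_sq_le_of_orthogonal b hb hV _) (Nat.cast_nonneg _)
    _ = Fintype.card Λ * (V * Fintype.card W) := by
        rw [← Finset.mul_sum, Finset.sum_comm]
        simp

/-- A classifier that is constant on the cells of a partition which hardly correlates with the
labels is hardly better than a constant one. -/
lemma disagreement_ge (g : W → Λ) (u : Λ → ℝ) (hu : ∀ l, u l = 0 ∨ u l = 1) (χ : W → ℝ)
    (hχ : ∀ w, χ w = 0 ∨ χ w = 1) {p : ℝ} (hp : ∑ w, χ w = p * Fintype.card W)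
    (hp' : p ≤ 1 / 2) :
    p * Fintype.card W - 2 * correlation g (fun w => χ w - p) ≤ ∑ w, (u (g w) - χ w) ^ 2 := by
  have h₁ : ∑ w, u (g w) * (χ w - p) ≤ correlation g (fun w => χ w - p) := by
    have : ∀ w, u (g w) * (χ w - p) = ∑ l, u l * ((if g w = l then 1 else 0) * (χ w - p)) := by
      intro w
      simp
    simp_rw [this]
    rw [Finset.sum_comm]
    refine Finset.sum_le_sum fun l _ => ?_
    rw [← Finset.mul_sum]
    rcases hu l with h | h
    · rw [h, zero_mul]
      exact abs_nonneg _
    · rw [h, one_mul]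
      exact le_abs_self _
  -- For values 0 and 1 squares disappear. The term with `1 - 2 * p` is then dropped, which is where
  -- `p ≤ 1 / 2` enters.
  have h₂ : ∀ w, (u (g w) - χ w) ^ 2 =
      u (g w) * (1 - 2 * p) + χ w - 2 * (u (g w) * (χ w - p)) := by
    intro w
    rcases hu (g w) with h | h <;> rcases hχ w with h' | h' <;> rw [h, h'] <;> ring
  have h₃ : 0 ≤ ∑ w, u (g w) * (1 - 2 * p) := by
    refine Finset.sum_nonneg fun w _ => mul_nonneg ?_ (by linarith)
    rcases hu (g w) with h | h <;> rw [h]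
    exact zero_le_one
  simp_rw [h₂]
  rw [Finset.sum_sub_distrib, Finset.sum_add_distrib, hp, ← Finset.mul_sum]
  linarith

end Correlation

/-! ### Functions of single coordinates. -/

section Coordinates

variable {S : Type*} [Fintype S] {d : ℕ}

lemma sum_coordinate (i : Fin (d + 1)) (c : S → ℝ) :
    ∑ w : Fin (d + 1) → S, c (w i) = (∑ s, c s) * Fintype.card (Fin d → S) := by
  rw [← (Fin.insertNthEquiv (fun _ => S) i).sum_comp, Fintype.sum_prod_type, Finset.sum_mul]
  refine Finset.sum_congr rfl fun s _ => ?_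
  simp [mul_comm]

/-- With all coordinates but `i` fixed, the factor `b (w j)` is constant and the sum over `w i`
vanishes. -/
lemma sum_coordinate_mul {i j : Fin (d + 1)} (hij : i ≠ j) {b : S → ℝ} (hb : ∑ s, b s = 0) :
    ∑ w : Fin (d + 1) → S, b (w i) * b (w j) = 0 := by
  obtain ⟨k, rfl⟩ := Fin.exists_succAbove_eq hij.symm
  rw [← (Fin.insertNthEquiv (fun _ => S) i).sum_comp, Fintype.sum_prod_type_right]
  refine Finset.sum_eq_zero fun y _ => ?_
  simp [← Finset.sum_mul, hb]

lemma card_succ_pi :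
    (Fintype.card (Fin (d + 1) → S) : ℝ) = Fintype.card S * Fintype.card (Fin d → S) := by
  simp only [Fintype.card_fun, Fintype.card_fin]
  push_cast
  ring

variable {χ : S → ℝ} {p : ℝ}

lemma sum_indicator (hp : ∑ s, χ s = p * Fintype.card S) (i : Fin (d + 1)) :
    ∑ w : Fin (d + 1) → S, χ (w i) = p * Fintype.card (Fin (d + 1) → S) := by
  rw [sum_coordinate, hp, card_succ_pi, mul_assoc]

/-- Centered indicators of different coordinates are orthogonal. -/
lemma centered_orthogonal (hχ : ∀ s, χ s = 0 ∨ χ s = 1) (hp : ∑ s, χ s = p * Fintype.card S)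
    (i j : Fin (d + 1)) :
    ∑ w : Fin (d + 1) → S, (χ (w i) - p) * (χ (w j) - p) =
      if i = j then p * (1 - p) * Fintype.card (Fin (d + 1) → S) else 0 := by
  have h0 : ∑ s, (χ s - p) = 0 := by
    rw [Finset.sum_sub_distrib, hp, Finset.sum_const, Finset.card_univ, nsmul_eq_mul]
    ring
  split_ifs with h
  · subst h
    have : ∀ w : Fin (d + 1) → S, (χ (w i) - p) * (χ (w i) - p) =
        (1 - 2 * p) * χ (w i) + p ^ 2 := by
      intro w
      rcases hχ (w i) with h | h <;> rw [h] <;> ring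
    simp_rw [this]
    rw [Finset.sum_add_distrib, ← Finset.mul_sum, sum_indicator hp, Finset.sum_const,
      Finset.card_univ, nsmul_eq_mul]
    ring
  · exact sum_coordinate_mul h (b := fun s => χ s - p) h0

lemma sum_sq_sub_coordinate (hχ : ∀ s, χ s = 0 ∨ χ s = 1) (hp : ∑ s, χ s = p * Fintype.card S)
    {i j : Fin (d + 1)} (hij : i ≠ j) :
    ∑ w : Fin (d + 1) → S, (χ (w i) - χ (w j)) ^ 2 =
      2 * (p * (1 - p)) * Fintype.card (Fin (d + 1) → S) := by
  have : ∀ w : Fin (d + 1) → S, (χ (w i) - χ (w j)) ^ 2 =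
      (χ (w i) - p) * (χ (w i) - p) + (χ (w j) - p) * (χ (w j) - p) -
        2 * ((χ (w i) - p) * (χ (w j) - p)) := fun w => by ring
  simp_rw [this]
  rw [Finset.sum_sub_distrib, Finset.sum_add_distrib, ← Finset.mul_sum,
    centered_orthogonal hχ hp, centered_orthogonal hχ hp, centered_orthogonal hχ hp,
    if_pos rfl, if_pos rfl, if_neg hij]
  ring

end Coordinates

/-- The states can be split evenly between two actions. -/
lemma exists_balanced (S A : Type*) [Fintype S] [Fintype A] [DecidableEq A]
    (hS : 2 ≤ Fintype.card S) (hA : 2 ≤ Fintype.card A) :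
    ∃ (f : S → A) (a : A) (p : ℝ),
      ∑ s, (if f s = a then (1 : ℝ) else 0) = p * Fintype.card S ∧ 1 / 3 ≤ p ∧ p ≤ 1 / 2 := by
  classical
  obtain ⟨a, a', ha⟩ := Fintype.one_lt_card_iff.1 hA
  obtain ⟨B, -, hB⟩ := Finset.exists_subset_card_eq (s := (Finset.univ : Finset S))
    (n := Fintype.card S / 2) (by rw [Finset.card_univ]; omega)
  have hpos : (0 : ℝ) < Fintype.card S := by exact_mod_cast (by omega : 0 < Fintype.card S)
  -- Rounding down half of the states is worst for three states, where the fraction is 1/3.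
  refine ⟨fun s => if s ∈ B then a else a', a, (Fintype.card S / 2 : ℕ) / Fintype.card S,
    ?_, ?_, ?_⟩
  · rw [div_mul_cancel₀ _ hpos.ne', ← hB]
    have : ∀ s, ((if s ∈ B then a else a') = a) ↔ s ∈ B := by
      intro s
      by_cases hs : s ∈ B <;> simp [hs, ha.symm]
    simp [this]
  · rw [div_le_div_iff₀ (by norm_num) hpos, one_mul]
    exact_mod_cast (by omega : Fintype.card S ≤ Fintype.card S / 2 * 3)
  · rw [div_le_div_iff₀ hpos (by norm_num), one_mul]
    exact_mod_cast (by omega : Fintype.card S / 2 * 2 ≤ Fintype.card S)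

end VideoRL

namespace VideoRL

lemma interact_support {X S Ξ A O : Type} (M : ExBlockMDP X S Ξ A) (H : ℕ) (φ : Fin H → X → O)
    (alg : OnlineAlg O A H) (G : Set (Episode O A H))
    (hG : ∀ past, ∀ τ ∈ (M.episode H φ (alg.act past)).support, τ ∈ G) (N : ℕ)
    (past : List (Episode O A H)) (hpast : ∀ τ ∈ past, τ ∈ G) :
    ∀ l ∈ (M.interact H φ alg N past).support, ∀ τ ∈ l, τ ∈ G := by
  induction N generalizing past with
  | zero =>
    intro l hl
    rw [ExBlockMDP.interact, PMF.mem_support_pure_iff] at hl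
    rwa [hl]
  | succ N ih =>
    intro l hl
    rw [ExBlockMDP.interact, PMF.mem_support_bind_iff] at hl
    obtain ⟨σ, hσ, hl⟩ := hl
    refine ih (past ++ [σ]) (fun τ hτ => ?_) l hl
    rcases List.mem_append.1 hτ with h | h
    · exact hpast τ h
    · rw [List.mem_singleton.1 h]
      exact hG past σ hσ

noncomputable section

/-! ### Failure of decoders with few values. -/

namespace staticMDP

open Classical in
/-- The indicator of the states in which the action `a` is optimal. -/
def indicator {S A : Type} (f : S → A) (a : A) (s : S) : ℝ := if f s = a then 1 else 0

lemma indicator_eq {S A : Type} (f : S → A) (a : A) (s : S) :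
    indicator f a s = 0 ∨ indicator f a s = 1 := by
  unfold indicator
  split_ifs <;> simp

variable {S A : Type} [Fintype S] [Nonempty S] {T : ℕ} [NeZero T] {d : ℕ} {f : S → A}
  {i : Fin (d + 1)} {a : A} {p : ℝ}

/-- A policy loses at least as much as its first step loses by confusing `a` with the other
actions. -/
lemma disagreement_le_gap {H : ℕ} [NeZero H] (π : Fin H → Fin T × (Fin (d + 1) → S) → A) :
    ∑ w : Fin (d + 1) → S,
        (indicator id a (π 0 (frame T w 0)) - indicator f a (w i)) ^ 2 ≤
      (H - (staticMDP T d f i).value H π) * Fintype.card (Fin (d + 1) → S) := by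
  classical
  rw [value_eq, sub_mul, div_mul_cancel₀ _ card_pos.ne', mul_comm, ← nsmul_eq_mul,
    ← Finset.card_univ, ← Finset.sum_const, ← Finset.sum_sub_distrib]
  refine Finset.sum_le_sum fun w _ => ?_
  have h₁ : (H : ℝ) - ∑ h : Fin H, (staticMDP T d f i).reward (w i) (π h (frame T w h)) =
      ∑ h : Fin H, (1 - (staticMDP T d f i).reward (w i) (π h (frame T w h))) := by
    rw [Finset.sum_sub_distrib]
    simp
  have h₂ : 1 - (staticMDP T d f i).reward (w i) (π 0 (frame T w (0 : Fin H))) ≤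
      ∑ h : Fin H, (1 - (staticMDP T d f i).reward (w i) (π h (frame T w h))) :=
    Finset.single_le_sum
      (f := fun h : Fin H => 1 - (staticMDP T d f i).reward (w i) (π h (frame T w h)))
      (fun h _ => sub_nonneg.2 (reward_le_one _ _)) (Finset.mem_univ 0)
  rw [h₁]
  refine le_trans ?_ h₂
  rw [Fin.val_zero, reward_apply]
  by_cases h : π 0 (frame T w 0) = f (w i)
  · simp [indicator, h]
  · rw [if_neg h, sub_zero]
    rcases indicator_eq id a (π 0 (frame T w 0)) with h' | h' <;>
      rcases indicator_eq f a (w i) with h'' | h'' <;> rw [h', h''] <;> norm_num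

/-- The instances in which some policy that sees the state through `φ` is nearly optimal are
few. -/
lemma ncard_solvable_le {H L : ℕ} [NeZero H] (hp : ∑ s, indicator f a s = p * Fintype.card S)
    (hp₁ : 1 / 3 ≤ p) (hp₂ : p ≤ 1 / 2) (φ : Fin H → Fin T × (Fin (d + 1) → S) → Fin L) :
    (({i : Fin (d + 1) | ¬ ∀ ψ : Fin H → Fin L → A,
      5 / 16 ≤ H - (staticMDP T d f i).value H (compose ψ φ)} : Set (Fin (d + 1))).ncard : ℝ) ≤
        2304 * L := by
  classical
  set m : ℝ := ((Fintype.card (Fin (d + 1) → S) : ℕ) : ℝ) with hm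
  have hm0 : 0 < m := card_pos
  set b : Fin (d + 1) → (Fin (d + 1) → S) → ℝ := fun i w => indicator f a (w i) - p with hb
  set g : (Fin (d + 1) → S) → Fin L := fun w => φ 0 (frame T w 0) with hg
  have hV : 0 < p * (1 - p) * m := by
    have : 0 < 1 - p := by linarith
    have : 0 < p := by linarith
    positivity
  -- The threshold `m / 96` leaves a loss of at least 1/3 − 2/96 = 5/16 per vector, and allows at
  -- most 96² / 4 = 2304 exceptional coordinates per cell.
  have hcount := ncard_correlation_le b
    (fun i j => centered_orthogonal (indicator_eq f a) hp i j) hV g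
    (div_nonneg hm0.le (by norm_num : (0 : ℝ) ≤ 96))
  rw [Fintype.card_fin, ← hm] at hcount
  have hsub : {i : Fin (d + 1) | ¬ ∀ ψ : Fin H → Fin L → A,
      5 / 16 ≤ H - (staticMDP T d f i).value H (compose ψ φ)} ⊆
        {i | m / 96 < correlation g (b i)} := by
    intro i hi
    by_contra hc
    refine hi fun ψ => ?_
    have hc' : correlation g (b i) ≤ m / 96 := not_lt.1 hc
    have h₁ := disagreement_ge g (fun l => indicator id a (ψ 0 l))
      (fun l => indicator_eq id a _) (fun w : Fin (d + 1) → S => indicator f a (w i))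
      (fun w => indicator_eq f a _) (sum_indicator hp i) hp₂
    have h₂ := disagreement_le_gap (f := f) (i := i) (a := a) (compose ψ φ)
    have h₃ : 5 / 16 * m ≤ (H - (staticMDP T d f i).value H (compose ψ φ)) * m := by
      refine le_trans ?_ (h₁.trans h₂)
      rw [← hm]
      nlinarith
    exact le_of_mul_le_mul_right h₃ hm0
  have hle : (({i : Fin (d + 1) | ¬ ∀ ψ : Fin H → Fin L → A,
      5 / 16 ≤ H - (staticMDP T d f i).value H (compose ψ φ)} : Set (Fin (d + 1))).ncard : ℝ) ≤
        ({i | m / 96 < correlation g (b i)} : Set (Fin (d + 1))).ncard := by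
    exact_mod_cast Set.ncard_le_ncard hsub (Set.toFinite _)
  refine hle.trans (le_of_mul_le_mul_right (hcount.trans ?_) (by positivity : 0 < (m / 96) ^ 2))
  have hpp : p * (1 - p) ≤ 1 / 4 := by nlinarith [sq_nonneg (p - 1 / 2)]
  have hL : (0 : ℝ) ≤ L * m ^ 2 := by positivity
  calc (L : ℝ) * (p * (1 - p) * m * m) = p * (1 - p) * (L * m ^ 2) := by ring
    _ ≤ 1 / 4 * (L * m ^ 2) := mul_le_mul_of_nonneg_right hpp hL
    _ = 2304 * L * (m / 96) ^ 2 := by ring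

/-- The law of the decoder is the same for all instances, as the videos are. -/
lemma decoderLaw_eq (Θ : PMF (Fin T × (Fin (d + 1) → S) → PMF A)) (n T' : ℕ) {Φ : Type}
    (A₁ : (Fin n → Fin T' → Fin T × (Fin (d + 1) → S)) → PMF Φ) (i j : Fin (d + 1)) :
    (staticMDP T d f i).decoderLaw Θ n T' A₁ = (staticMDP T d f j).decoderLaw Θ n T' A₁ := by
  rw [ExBlockMDP.decoderLaw, ExBlockMDP.decoderLaw, videoLaw_eq, videoLaw_eq]

/-- For some instance, the decoder learned from videos is useless with high probability. -/
lemma exists_prob_decoder_ge {H L n T' : ℕ} [NeZero H]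
    (hp : ∑ s, indicator f a s = p * Fintype.card S) (hp₁ : 1 / 3 ≤ p) (hp₂ : p ≤ 1 / 2)
    (Θ : PMF (Fin T × (Fin (d + 1) → S) → PMF A))
    (A₁ : (Fin n → Fin T' → Fin T × (Fin (d + 1) → S)) →
      PMF (Fin H → Fin T × (Fin (d + 1) → S) → Fin L)) :
    ∃ i, 1 - 2304 * L / (d + 1) ≤ prob ((staticMDP T d f i).decoderLaw Θ n T' A₁)
      {φ | ∀ ψ : Fin H → Fin L → A,
        5 / 16 ≤ H - (staticMDP T d f i).value H (compose ψ φ)} := by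
  have := Fintype.ofFinite (Fin H → Fin T × (Fin (d + 1) → S) → Fin L)
  -- The decoder law is common to all instances, so the one of coordinate 0 stands for all in the
  -- averaging.
  obtain ⟨i, hi⟩ := exists_prob_le ((staticMDP T d f 0).decoderLaw Θ n T' A₁)
    (fun i : Fin (d + 1) => {φ | ∀ ψ : Fin H → Fin L → A,
        5 / 16 ≤ H - (staticMDP T d f i).value H (compose ψ φ)}ᶜ)
    (fun φ => ncard_solvable_le hp hp₁ hp₂ φ)
  refine ⟨i, ?_⟩
  rw [decoderLaw_eq Θ n T' A₁ i 0]
  rw [prob_compl, Fintype.card_fin, ← le_div_iff₀ (by positivity)] at hi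
  push_cast at hi
  linarith

/-! ### Online learning by elimination. -/

/-- The episodes whose first reward, for the action `a`, is explained by the coordinate `j`. -/
def consistent (T : ℕ) [NeZero T] {d : ℕ} (f : S → A) (a : A) (H : ℕ) [NeZero H]
    (j : Fin (d + 1)) : Set (Episode (Fin T × (Fin (d + 1) → S)) A H) :=
  {τ | (τ 0).2.2 = indicator f a ((τ 0).1.2 j)}

/-- A coordinate that explains the rewards of all given episodes. -/
def select (f : S → A) (a : A) {H : ℕ} [NeZero H]
    (l : List (Episode (Fin T × (Fin (d + 1) → S)) A H)) : Fin (d + 1) :=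
  Classical.epsilon fun j => ∀ τ ∈ l, τ ∈ consistent T f a H j

/-- The algorithm that always plays `a` and selects a coordinate that explains all rewards. -/
def learner (T : ℕ) [NeZero T] (d : ℕ) (f : S → A) (a : A) (H : ℕ) [NeZero H] :
    OnlineAlg (Fin T × (Fin (d + 1) → S)) A H where
  act _ := detAgent fun _ _ => a
  output l := PMF.pure fun _ x => f (x.2 (select f a l))

lemma reward_eq_indicator (s : S) : (staticMDP T d f i).reward s a = indicator f a s := by
  classical
  rw [reward_apply, indicator]
  simp [eq_comm]

/-- The probability that a wrong coordinate explains the rewards of an episode. -/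
lemma prob_consistent_le {H : ℕ} [NeZero H] (hp : ∑ s, indicator f a s = p * Fintype.card S)
    (hp₁ : 1 / 3 ≤ p) (hp₂ : p ≤ 1 / 2) {j : Fin (d + 1)} (hij : i ≠ j) :
    prob ((staticMDP T d f i).rawEpisode H (detAgent fun _ _ => a))
      (consistent T f a H j) ≤ 5 / 9 := by
  classical
  rw [rawEpisode_detAgent, prob_map, prob_uniform, div_le_iff₀ card_pos]
  have h : ∀ w : Fin (d + 1) → S,
      (if w ∈ detEpisode T f i (fun (_ : Fin H) _ => a) ⁻¹'
        consistent T f a H j then (1 : ℝ) else 0) =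
      1 - (indicator f a (w i) - indicator f a (w j)) ^ 2 := by
    intro w
    have : w ∈ detEpisode T f i (fun (_ : Fin H) _ => a) ⁻¹'
        consistent T f a H j ↔
        indicator f a (w i) = indicator f a (w j) := by
      rw [← reward_eq_indicator (T := T) (d := d) (f := f) (i := i)]
      rfl
    simp only [this]
    rcases indicator_eq f a (w i) with h | h <;> rcases indicator_eq f a (w j) with h' | h' <;>
      rw [h, h'] <;> norm_num
  simp_rw [h]
  rw [Finset.sum_sub_distrib, sum_sq_sub_coordinate (indicator_eq f a) hp hij, Finset.sum_const,
    Finset.card_univ, nsmul_eq_mul, mul_one]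
  -- The two indicators agree with probability `1 - 2 * p * (1 - p)`; the extreme case `p = 1 / 3`
  -- gives 5/9.
  have hpp : 2 / 9 ≤ p * (1 - p) := by nlinarith
  have hc : (0 : ℝ) < Fintype.card (Fin (d + 1) → S) := card_pos
  nlinarith

/-- The true coordinate explains every reward, so a wrong choice requires some wrong coordinate to
survive all `N` episodes. A right choice has gap zero, which is why `N` need not depend on `ε`. -/
lemma one_sub_le_prob_learner {H : ℕ} [NeZero H]
    (hp : ∑ s, indicator f a s = p * Fintype.card S) (hp₁ : 1 / 3 ≤ p) (hp₂ : p ≤ 1 / 2)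
    (N : ℕ) {ε : ℝ} (hε : 0 ≤ ε) :
    1 - (d + 1) * (5 / 9 : ℝ) ^ N ≤
      prob ((staticMDP T d f i).outputLaw H N (fun _ x => x) (learner T d f a H))
        {π | (staticMDP T d f i).optValue H - (staticMDP T d f i).value H π ≤ ε} := by
  classical
  set M := staticMDP T d f i with hM
  set alg := learner T d f a H with halg
  have h₁ : prob (M.interact H (fun _ x => x) alg N []) {l | select f a l = i} ≤
      prob (M.outputLaw H N (fun _ x => x) alg) {π | M.optValue H - M.value H π ≤ ε} := by
    refine prob_le_prob_bind _ _ fun l hl π hπ => ?_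
    rw [halg, learner, PMF.mem_support_pure_iff] at hπ
    have hl' : select f a l = i := hl
    rw [hl'] at hπ
    change M.optValue H - M.value H π ≤ ε
    rw [hπ, hM, value_decode, optValue_eq, sub_self]
    exact hε
  refine le_trans ?_ h₁
  have hact : ∀ past, M.episode H (fun _ x => x) (alg.act past) =
      M.rawEpisode H (detAgent fun _ _ => a) := fun _ => rfl
  have hsub : {l | select f a l = i}ᶜ ∩ (M.interact H (fun _ x => x) alg N []).support ⊆
      ⋃ j, {l | i ≠ j ∧ ∀ τ ∈ l, τ ∈ consistent T f a H j} := by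
    rintro l ⟨hl, hl'⟩
    have hi : ∀ τ ∈ l, τ ∈ consistent T f a H i := by
      refine interact_support M H _ alg (consistent T f a H i) (fun past τ hτ => ?_) N []
        (by simp) l hl'
      rw [hact, rawEpisode_detAgent, PMF.mem_support_map_iff] at hτ
      obtain ⟨w, -, rfl⟩ := hτ
      exact reward_eq_indicator (T := T) (i := i) _
    exact Set.mem_iUnion.2 ⟨select f a l, Ne.symm hl,
      Classical.epsilon_spec (p := fun j => ∀ τ ∈ l, τ ∈ consistent T f a H j) ⟨i, hi⟩⟩
  have h₂ : ∀ j, prob (M.interact H (fun _ x => x) alg N [])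
      {l | i ≠ j ∧ ∀ τ ∈ l, τ ∈ consistent T f a H j} ≤ (5 / 9 : ℝ) ^ N := by
    intro j
    by_cases hij : i = j
    · rw [prob_eq_zero fun l _ hl => hl.1 hij]
      positivity
    · refine (prob_mono_support _ fun l hl => hl.1.2).trans (interact_all_le M H _ alg
        (consistent T f a H j) (fun past => ?_) N)
      rw [hact]
      exact prob_consistent_le hp hp₁ hp₂ hij
  have h₃ := (prob_mono_support _ hsub).trans (prob_iUnion_le _ _ h₂)
  rw [prob_compl, Fintype.card_fin] at h₃
  push_cast at h₃
  linarith

end staticMDP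

/-! ### Sample size. -/

/-- The number of episodes that suffices for the union bound over `m` wrong coordinates. -/
lemma exists_episodes {m δ : ℝ} (hm : 1 ≤ m) (hδ : 0 < δ) (hδ' : δ < 1) :
    ∃ N : ℕ, m * (5 / 9 : ℝ) ^ N ≤ δ ∧
      (N : ℝ) ≤ 9 / 4 * (Real.log m + Real.log (1 / δ)) + 1 := by
  have hm0 : 0 < m := by linarith
  have hlog : Real.log m + Real.log (1 / δ) = Real.log (m / δ) := by
    rw [← Real.log_mul hm0.ne' (by positivity), mul_one_div]
  have h1 : 1 ≤ m / δ := by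
    rw [le_div_iff₀ hδ]
    linarith
  refine ⟨⌈9 / 4 * Real.log (m / δ)⌉₊, ?_, ?_⟩
  · set N := ⌈9 / 4 * Real.log (m / δ)⌉₊
    have hN : 9 / 4 * Real.log (m / δ) ≤ N := Nat.le_ceil _
    have h2 : (5 / 9 : ℝ) ^ N ≤ Real.exp (-(Real.log (m / δ))) := by
      -- From `1 + x ≤ exp x` at `x = -4/9`; hence the factor 9/4 in the number of episodes.
      calc (5 / 9 : ℝ) ^ N ≤ Real.exp (-(4 / 9)) ^ N := by
            refine pow_le_pow_left₀ (by norm_num) ?_ N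
            have := Real.add_one_le_exp (-(4 / 9) : ℝ)
            linarith
        _ = Real.exp (N * (-(4 / 9))) := by rw [Real.exp_nat_mul]
        _ ≤ _ := Real.exp_le_exp.2 (by linarith)
    rw [Real.exp_neg, Real.exp_log (by positivity), inv_div] at h2
    calc m * (5 / 9 : ℝ) ^ N ≤ m * (δ / m) := mul_le_mul_of_nonneg_left h2 hm0.le
      _ = δ := by field_simp
  · rw [hlog]
    exact (Nat.ceil_lt_add_one (mul_nonneg (by norm_num) (Real.log_nonneg h1))).le

/-- The dimension is exponential in `1 / ε` but affects the number of episodes only through its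
logarithm. The 16 is a crude bound for the logarithm of the constant `2 ^ 16`. -/
lemma log_dimension_le {ε δ : ℝ} (hε : 0 < ε) (hδ : 0 < δ) (hδ' : δ < 1) :
    Real.log ((⌈36864 * (2 : ℝ) ^ (1 / (4 * ε) - 1) / δ⌉₊ : ℝ) + 1) ≤
      16 + 1 / (4 * ε) + Real.log (1 / δ) := by
  set x : ℝ := (2 : ℝ) ^ (1 / (4 * ε)) with hx
  have hx1 : 1 ≤ x := Real.one_le_rpow (by norm_num) (by positivity)
  have hx2 : (2 : ℝ) ^ (1 / (4 * ε) - 1) = x / 2 := by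
    rw [Real.rpow_sub (by norm_num), Real.rpow_one]
  have hδ1 : 1 ≤ 1 / δ := by
    rw [le_div_iff₀ hδ]
    linarith
  have hc := (Nat.ceil_lt_add_one (a := 36864 * (2 : ℝ) ^ (1 / (4 * ε) - 1) / δ)
    (by positivity)).le
  have hbound : (⌈36864 * (2 : ℝ) ^ (1 / (4 * ε) - 1) / δ⌉₊ : ℝ) + 1 ≤
      2 ^ 16 * x * (1 / δ) := by
    have h1 : 1 ≤ x * (1 / δ) := one_le_mul_of_one_le_of_one_le hx1 hδ1
    calc (⌈36864 * (2 : ℝ) ^ (1 / (4 * ε) - 1) / δ⌉₊ : ℝ) + 1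
        ≤ 36864 * (2 : ℝ) ^ (1 / (4 * ε) - 1) / δ + 1 + 1 := by linarith
      _ = 18432 * (x * (1 / δ)) + 2 := by
        rw [hx2]
        ring
      _ ≤ 2 ^ 16 * x * (1 / δ) := by nlinarith
  have hlog2 : Real.log 2 ≤ 1 := by
    have := Real.log_two_lt_d9
    linarith
  refine (Real.log_le_log (by positivity) hbound).trans ?_
  rw [Real.log_mul (by positivity) (by positivity), Real.log_mul (by positivity) (by positivity),
    Real.log_pow, hx, Real.log_rpow (by norm_num)]
  have h4 : 0 < 1 / (4 * ε) := by positivity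
  push_cast
  nlinarith

end

end VideoRL

/-! ### Assembly of the theorem. -/

theorem theorem3 :
    ∃ (C : ℝ) (r : ℕ),
      ∀ (S A : Type) [Fintype S] [Fintype A] (H K : ℕ) [NeZero H] (ε δ : ℝ),
        2 ≤ Fintype.card S → 2 ≤ Fintype.card A → 2 ≤ H → 1 ≤ K →
        0 < ε → ε < 1 → 0 < δ → δ < 1 →
        ∃ (X Ξ : Type) (_ : Finite X) (_ : Finite Ξ)
          (𝓜 : Set (ExBlockMDP X S Ξ A × PMF (X → PMF A))),
          -- standing assumptions, coverage and margins, for all members of the class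
          (∀ I ∈ 𝓜, I.1.EncodesTime (H + K) ∧ I.1.DataCollection I.2 H ∧
            ∀ ω : PMF (Fin K), I.1.Margin I.2 H K ω) ∧
          -- the class is PAC learnable from online trajectories with polynomially many episodes
          (∀ ε' δ' : ℝ, 0 < ε' → ε' ≤ ε → 0 < δ' → δ' ≤ δ →
            ∃ N : ℕ,
              (N : ℝ) ≤ C * ((Fintype.card S : ℝ) + Fintype.card A + H + 1 / ε' +
                Real.log (1 / δ')) ^ r ∧
              PACLearnable (Prod.fst '' 𝓜) H N ε' δ') ∧
          -- learning through a decoder trained on video fails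
          ∀ L : ℕ, (L : ℝ) ≤ (2 : ℝ) ^ (1 / (4 * ε) - 1) →
            ∀ (n N : ℕ)
              (A₁ : (Fin n → Fin (H + K) → X) → PMF (Fin H → X → Fin L))
              (A₂ : (Fin H → X → Fin L) → OnlineAlg (Fin L) A H),
              ∃ I ∈ 𝓜,
                1 - δ ≤ prob (I.1.decoderLaw I.2 n (H + K) A₁)
                  {φ | ∀ ψ ∈ (I.1.outputLaw H N φ (A₂ φ)).support,
                    ε < I.1.optValue H - I.1.value H (compose ψ φ)} ∧
                ε < I.1.optValue H -
                  expect ((I.1.decoderLaw I.2 n (H + K) A₁).bind fun φ =>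
                    (I.1.outputLaw H N φ (A₂ φ)).map fun ψ => compose ψ φ)
                    (fun π => I.1.value H π) := by
  classical
  refine ⟨10, 1, fun S A _ _ H K _ ε δ hS hA hH hK hε hε1 hδ hδ1 => ?_⟩
  obtain ⟨f, a, p, hp, hp₁, hp₂⟩ := exists_balanced S A hS hA
  have hp : ∑ s, staticMDP.indicator f a s = p * Fintype.card S := by
    rw [← hp]
    refine Finset.sum_congr rfl fun s _ => ?_
    rw [staticMDP.indicator]
  have : Nontrivial S := Fintype.one_lt_card_iff_nontrivial.1 hS
  have : Nonempty A := ⟨a⟩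
  have : NeZero (H + K) := ⟨by omega⟩
  -- Here 36864 = 16 · 2304, so that the exceptional coordinates are at most a fraction `δ / 16` of
  -- all.
  set d : ℕ := ⌈36864 * (2 : ℝ) ^ (1 / (4 * ε) - 1) / δ⌉₊ with hd
  have hd' : 36864 * (2 : ℝ) ^ (1 / (4 * ε) - 1) / δ ≤ d := Nat.le_ceil _
  refine ⟨Fin (H + K) × (Fin (d + 1) → S), Fin (H + K) × (Fin d → S), inferInstance,
    inferInstance, Set.range fun i =>
      (staticMDP (H + K) d f i, PMF.pure fun _ => PMF.uniformOfFintype A), ?_, ?_, ?_⟩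
  · rintro _ ⟨i, rfl⟩
    exact ⟨staticMDP.encodesTime le_rfl, staticMDP.dataCollection _ (by omega),
      fun ω => staticMDP.margin _ ω⟩
  · intro ε' δ' hε' hεε' hδ' hδδ'
    obtain ⟨N, hN₁, hN₂⟩ := exists_episodes (m := (d : ℝ) + 1)
      (le_add_of_nonneg_left (Nat.cast_nonneg d)) hδ' (hδδ'.trans_lt hδ1)
    refine ⟨N, ?_, staticMDP.learner (H + K) d f a H, ?_⟩
    · have h₁ := log_dimension_le hε hδ hδ1
      have h₂ : Real.log (1 / δ) ≤ Real.log (1 / δ') :=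
        Real.log_le_log (by positivity) (one_div_le_one_div_of_le hδ' hδδ')
      have h₃ : 0 ≤ Real.log (1 / δ) :=
        Real.log_nonneg ((one_le_div hδ).2 hδ1.le)
      have h₄ : 1 / ε ≤ 1 / ε' := one_div_le_one_div_of_le hε' hεε'
      have h₅ : 1 / (4 * ε) = 1 / ε / 4 := by
        rw [div_div, mul_comm]
      have h₆ : 0 < 1 / ε := by positivity
      -- The additive constant 9/4 · 16 + 1 = 37 is absorbed by ten times `|S| + |A| + H ≥ 6`.
      have h₇ : (2 : ℝ) ≤ Fintype.card S := by exact_mod_cast hS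
      have h₈ : (2 : ℝ) ≤ Fintype.card A := by exact_mod_cast hA
      have h₉ : (2 : ℝ) ≤ H := by exact_mod_cast hH
      rw [pow_one]
      linarith
    · rintro _ ⟨_, ⟨i, rfl⟩, rfl⟩
      exact le_trans (by linarith)
        (staticMDP.one_sub_le_prob_learner hp hp₁ hp₂ N hε'.le)
  · intro L hL n N A₁ A₂
    obtain ⟨i, hi⟩ := staticMDP.exists_prob_decoder_ge (f := f) hp hp₁ hp₂
      (PMF.pure fun _ => PMF.uniformOfFintype A) A₁
    -- A decoder exists, so `Fin L` is nonempty. With the bound on `L` this forces `ε ≤ 1 / 4`,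
    -- below the loss 5/16.
    have hL1 : 1 ≤ L := by
      obtain ⟨φ, -⟩ := ((staticMDP (H + K) d f i).decoderLaw
        (PMF.pure fun _ => PMF.uniformOfFintype A) n (H + K) A₁).support_nonempty
      have := (φ 0 (0, fun _ => Classical.arbitrary S)).2
      omega
    have hε4 : ε ≤ 1 / 4 := by
      by_contra! hc
      have hneg : 1 / (4 * ε) - 1 < 0 := by
        rw [sub_neg, div_lt_one (by positivity)]
        linarith
      have := Real.rpow_lt_one_of_one_lt_of_neg (by norm_num : (1 : ℝ) < 2) hneg
      have : (1 : ℝ) ≤ L := by exact_mod_cast hL1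
      linarith
    have hbad : 2304 * (L : ℝ) / (d + 1) ≤ δ / 16 := by
      rw [div_le_iff₀ hδ] at hd'
      rw [div_le_iff₀ (by positivity)]
      nlinarith
    refine ⟨_, ⟨i, rfl⟩, ?_, ?_⟩
    · refine le_trans (by linarith) (hi.trans (prob_mono_support _ ?_))
      rintro φ ⟨hφ, -⟩ ψ -
      rw [staticMDP.optValue_eq]
      exact lt_of_lt_of_le (by linarith) (hφ ψ)
    · have := Fintype.ofFinite (Fin H → Fin (H + K) × (Fin (d + 1) → S) → A)
      rw [staticMDP.optValue_eq]
      -- Markov's inequality: the expected loss is at least 5/16 · 15/16 = 75/256 > 1/4. The slack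
      -- `δ / 16` instead of `δ` is needed here, since `δ` may be close to 1.
      refine lt_of_lt_of_le ?_ (expect_le_of_prob (c := 5 / 16) _ staticMDP.value_le)
      have hprob := hi.trans (prob_le_prob_bind _
        (fun φ => ((staticMDP (H + K) d f i).outputLaw H N φ (A₂ φ)).map fun ψ => compose ψ φ)
        (E := {π | 5 / 16 ≤ H - (staticMDP (H + K) d f i).value H π}) ?_)
      · linarith
      · intro φ hφ π hπ
        obtain ⟨ψ, -, rfl⟩ := (PMF.mem_support_map_iff _ _ _).1 hπ
        exact hφ ψ
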